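/- Let $d\ge 1$. An update family $\mathcal U$ is a finite set of finite subsets of $\mathbb Z^d\setminus\{0\}$. For $\omega\in\{0,1\}^{\mathbb Z^d}$ ($0$ = empty, $1$ = occupied) the constraint at $x$ is satisfied if for some $U\in\mathcal U$ one has $\omega_{x+u}=0$ for all $u\in U$. For $v\in\mathbb R^d\setminus\{0\}$ put $\mathbb H_v=\{z\in\mathbb R^d:\langle z,v\rangle<0\}$; $\mathcal U$ is oriented if $\bigcup_{U\in\mathcal U}U\subset\mathbb H_v$ for some $v\neq 0$. Let $q\in[0,1]$. Graphical construction: the sites $x\in\mathbb Z^d$ carry independent rate-one Poisson clocks with ring times $t_{x,1}<t_{x,2}<\cdots$ and, independently, independent coins $s_{x,k}\in\{0,1\}$ with $\mathbb P(s_{x,k}=1)=1-q$. A trajectory from $\omega$ is a map $\eta:[0,\infty)\to\{0,1\}^{\mathbb Z^d}$ with $\eta(0)=\omega$ such that $\eta_x$ changes only at rings at $x$, and at time $t=t_{x,k}$: if the constraint at $x$ is satisfied by $\eta(t-)$, then $\eta_x(t)=s_{x,k}$ (a legal update at $x$); otherwise $\eta_x(t)=\eta_x(t-)$. The KCM process from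 $\omega$ is the unique trajectory from $\omega$. Let $\mathcal U$ be oriented. Then almost surely there is, simultaneously for all $\omega$, exactly one trajectory from $\omega$, and: 1. (Oriented dependence) Let $v\ne0$ with $\bigcup_{U\in\mathcal U}U\subset\mathbb H_v$, let $x\in\mathbb Z^d$ and $A=(x+\mathbb H_v)\cap\mathbb Z^d$. The restricted process $(\eta_A(t))_{t\ge0}$ does not depend on the initial condition, clock rings and coin tosses outside $A$: there is a measurable map $F$, depending only on $\mathcal U,x,v$, such that for every $q$ and every realization of clocks and coins, almost surely, for all initial conditions $\omega$ and all $t\ge0$, $\eta_A(t)=F(\omega_A,(t_{y,k})_{y\in A,k},(s_{y,k})_{y\in A,k})(t)$. Moreover, if the initial condition $\xi$ is random (in particular, if it is deterministic), independent of the clocks and coins, and $\xi_A$ is independent of $\xi_{A^c}$, then $(\eta_A(t))_{t\ge0}$ is independent of $(\xi_{A^c},(t_{y,k})_{y\notin A,k},(s_{y,k})_{y\notin A,k})$. 2. (Exact equilibrium) Let $\omega$ be an initial configuration, $x\in\mathbb Z^d$, $t\ge0$, and let $\mathcal E_x(t)$ be the event that a legal update has occurred at $x$ by time $t$. The sets $\mathcal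 E_x(t)$ and $\{\eta_x(t)=1\}$ are events (measurable up to null sets), and if $\mathbb P_\omega(\mathcal E_x(t))>0$ then $$\mathbb P_\omega\bigl(\eta_x(t)=1\mid\mathcal E_x(t)\bigr)=1-q.$$ -/

import Mathlib

open MeasureTheory ProbabilityTheory
open scoped NNReal ENNReal

/-- Sites of the lattice `ℤ^d`. -/
abbrev Site (d : ℕ) := Fin d → ℤ

/-- Configurations: `0` means empty, `1` means occupied. -/
abbrev Config (d : ℕ) := Site d → Fin 2

/-- Realisations of the clocks: `τ x k` is the time of the `k`-th ring (`k = 0, 1, …`) at `x`. -/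
abbrev Clocks (d : ℕ) := Site d → ℕ → ℝ≥0

/-- Realisations of the coin tosses: `σ x k` is the coin used at the `k`-th ring at `x`. -/
abbrev Coins (d : ℕ) := Site d → ℕ → Fin 2

/-- A `d`-dimensional update family: finitely many finite subsets of `ℤ^d` minus the origin. -/
structure UpdateFamily (d : ℕ) where
  rules : Finset (Finset (Site d))
  zero_notMem : ∀ R ∈ rules, (0 : Site d) ∉ R

/-- The open half-space `H_v = {x ∈ ℝ^d : ⟨x, v⟩ < 0}`. -/
def halfSpace {d : ℕ} (v : Fin d → ℝ) : Set (Fin d → ℝ) :=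
  {z | z ⬝ᵥ v < 0}

/-- The lattice points of the translated half-space `x + H_v`. -/
def siteHalfSpace {d : ℕ} (v : Fin d → ℝ) (x : Site d) : Set (Site d) :=
  {y | (fun i => (y i : ℝ) - (x i : ℝ)) ∈ halfSpace v}

namespace UpdateFamily

variable {d : ℕ}

/-- All update rules are contained in the half-space `H_v`. -/
def ContainedIn (U : UpdateFamily d) (v : Fin d → ℝ) : Prop :=
  ∀ R ∈ U.rules, ∀ u ∈ R, (fun i => (u i : ℝ)) ∈ halfSpace v

/-- The update family is oriented. -/
def IsOriented (U : UpdateFamily d) : Prop :=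
  ∃ v : Fin d → ℝ, v ≠ 0 ∧ U.ContainedIn v

/-- The constraint at `x` is satisfied by `ω`: for some rule `R`, all of `x + R` is empty. -/
def Constraint (U : UpdateFamily d) (x : Site d) (ω : Config d) : Prop :=
  ∃ R ∈ U.rules, ∀ u ∈ R, ω (x + u) = 0

/-- The rules of the graphical construction. Starting from `ω`, the state of `x` changes only at
rings of the clock at `x`; at the `k`-th ring, at time `t = τ x k`, it is replaced by the coin toss
`σ x k` if the constraint at `x` is satisfied by the configuration just before time `t`
(a legal update), and it is left as it was just before time `t` otherwise. The topology on
configurations is the product of the discrete ones, so left limits are taken sitewise. -/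
structure IsTrajectory (U : UpdateFamily d) (ω : Config d) (τ : Clocks d) (σ : Coins d)
    (η : ℝ≥0 → Config d) : Prop where
  init : η 0 = ω
  const : ∀ (x : Site d) (s t : ℝ≥0), s ≤ t → (∀ k, τ x k ∉ Set.Ioc s t) → η t x = η s x
  legal : ∀ (x : Site d) (k : ℕ), U.Constraint x (Function.leftLim η (τ x k)) →
    η (τ x k) x = σ x k
  illegal : ∀ (x : Site d) (k : ℕ), ¬ U.Constraint x (Function.leftLim η (τ x k)) →
    η (τ x k) x = Function.leftLim η (τ x k) x

open Classical in
/-- The KCM process built from the initial condition, the clocks and the coins: the trajectory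
that follows the rules of the graphical construction. (The value on data for which it
does not exist or is not unique is a convention.) -/
noncomputable def kcm (U : UpdateFamily d) (ω : Config d) (τ : Clocks d) (σ : Coins d) :
    ℝ≥0 → Config d :=
  if h : ∃! η, U.IsTrajectory ω τ σ η then h.choose else fun _ => ω

/-- There has been a legal update at `x` by time `t` in the KCM process. -/
def LegalUpdateBy (U : UpdateFamily d) (ω : Config d) (τ : Clocks d) (σ : Coins d)
    (x : Site d) (t : ℝ≥0) : Prop :=
  ∃ k, τ x k ≤ t ∧ U.Constraint x (Function.leftLim (U.kcm ω τ σ) (τ x k))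

end UpdateFamily

/-- Waiting times between successive rings at `x` (the first one counted from time `0`). -/
def waitingTime {d : ℕ} (τ : Clocks d) (x : Site d) : ℕ → ℝ
  | 0 => (τ x 0 : ℝ)
  | k + 1 => (τ x (k + 1) : ℝ) - (τ x k : ℝ)

/-- Random clocks and coins of the graphical construction with parameter `q`: independent
rate-one Poisson clocks at the sites (that is, with i.i.d. exponential waiting times of mean one)
and, independently of them, independent coins equal to `1` with probability `1 - q`. -/
structure IsGraphical {d : ℕ} {Ω : Type*} [MeasurableSpace Ω] (P : Measure Ω) (q : ℝ)
    (T : Ω → Clocks d) (S : Ω → Coins d) : Prop where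
  measurable_clocks : Measurable T
  measurable_coins : Measurable S
  waitingTime_law : ∀ x k, P.map (fun w => waitingTime (T w) x k) = expMeasure 1
  coin_law : ∀ x k, P {w | S w x k = 1} = ENNReal.ofReal (1 - q)
  indep_waitingTime : iIndepFun (fun (p : Site d × ℕ) w => waitingTime (T w) p.1 p.2) P
  indep_coins : iIndepFun (fun (p : Site d × ℕ) w => S w p.1 p.2) P
  indep_clocks_coins : IndepFun T S P

/-! For clocks that ring in increasing order without accumulation, a trajectory is determined by its
set of legal rings: each site carries the coin of its last legal ring, or its initial value
(`stateOf`). Trajectories are thus the fixed points of the map sending a set of marked rings to the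
set of rings whose constraint holds in the induced configuration. Legality of a ring only looks at
earlier rings at displaced sites. If this influence relation is well-founded, induction shows that
the fixed point is unique and that the iterates of the map started from the empty set stabilise at
every ring (`RegularClocks.existsUnique_isTrajectory`).

Well-foundedness holds almost surely (`ae_wellFounded_influences`). The times along an infinite
descending chain converge, so a tail of the chain rings inside an arbitrarily short interval around
the limit. Orientation makes its sites distinct, hence their clocks independent, and a first-moment
count over paths rules this out once the number of displacements times the probability of a ring in
the interval is below one.

Both conclusions are then locality statements. A half-space is closed under displacements, so the
process there is a function of the data there. Legality of rings at `x` involves no coin at `x`;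
hence the coin of the `k`-th ring is independent of the event that this ring is the last legal one
by time `t`, and summing over `k` gives the equilibrium law (`measure_lastLegal_inter`). -/

namespace UpdateFamily

open Set Filter Topology

variable {d : ℕ}

/-! ### Trajectories as configurations generated by sets of legal rings -/

/-- All displacements occurring in the update rules. -/
def displacements (U : UpdateFamily d) : Finset (Site d) := U.rules.biUnion id

lemma constraint_congr (U : UpdateFamily d) {x : Site d} {ω ω' : Config d}
    (h : ∀ u ∈ U.displacements, ω (x + u) = ω' (x + u)) :
    U.Constraint x ω ↔ U.Constraint x ω' := by
  unfold Constraint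
  refine exists_congr fun R => and_congr_right fun hR => forall₂_congr fun u hu => ?_
  rw [h u (Finset.mem_biUnion.2 ⟨R, hR, hu⟩)]

/-- Ring `k` is the last one at `x` with time in `J` that is marked by `L`. -/
def LastMarked (τ : Clocks d) (L : Site d → ℕ → Prop) (J : Set ℝ≥0) (x : Site d) (k : ℕ) : Prop :=
  (τ x k ∈ J ∧ L x k) ∧ ∀ j, k < j → ¬ (τ x j ∈ J ∧ L x j)

open Classical in
/-- The configuration in which each site carries the coin of its last marked ring with time in
`J`, and its initial value if there is none. -/
noncomputable def stateOf (ω : Config d) (τ : Clocks d) (σ : Coins d) (L : Site d → ℕ → Prop)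
    (J : Set ℝ≥0) : Config d := fun x =>
  if (∃ k, LastMarked τ L J x k ∧ σ x k = 1) ∨ ((∀ k, ¬ (τ x k ∈ J ∧ L x k)) ∧ ω x = 1)
    then 1 else 0

/-- The clocks and the time window enter only through the set of marked indices, so both may change
as long as that set does not. -/
lemma stateOf_congr {ω ω' : Config d} {τ τ' : Clocks d} {σ σ' : Coins d}
    {L L' : Site d → ℕ → Prop} {J J' : Set ℝ≥0} {x : Site d} (hω : ω x = ω' x) (hσ : σ x = σ' x)
    (h : ∀ k, (τ x k ∈ J ∧ L x k) ↔ (τ' x k ∈ J' ∧ L' x k)) :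
    stateOf ω τ σ L J x = stateOf ω' τ' σ' L' J' x := by
  unfold stateOf
  classical
  refine if_congr (or_congr (exists_congr fun k => and_congr (and_congr (h k)
    (forall₂_congr fun j _ => not_congr (h j))) (by rw [hσ]))
    (and_congr (forall_congr' fun k => not_congr (h k)) (by rw [hω]))) rfl rfl

lemma fin_two_ite (a : Fin 2) : (if a = 1 then (1 : Fin 2) else 0) = a := by
  fin_cases a <;> rfl

lemma LastMarked.unique {τ : Clocks d} {L : Site d → ℕ → Prop} {J : Set ℝ≥0} {x : Site d} {j k : ℕ}
    (hj : LastMarked τ L J x j) (hk : LastMarked τ L J x k) : j = k := by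
  rcases lt_trichotomy j k with h | h | h
  · exact absurd hk.1 (hj.2 k h)
  · exact h
  · exact absurd hj.1 (hk.2 j h)

lemma LastMarked.stateOf_eq {ω : Config d} {τ : Clocks d} {σ : Coins d} {L : Site d → ℕ → Prop}
    {J : Set ℝ≥0} {x : Site d} {k : ℕ} (h : LastMarked τ L J x k) :
    stateOf ω τ σ L J x = σ x k := by
  have h1 : (∃ j, LastMarked τ L J x j ∧ σ x j = 1) ↔ σ x k = 1 :=
    ⟨fun ⟨j, hj, hs⟩ => hj.unique h ▸ hs, fun hs => ⟨k, h, hs⟩⟩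
  have h2 : ¬ ((∀ k, ¬ (τ x k ∈ J ∧ L x k)) ∧ ω x = 1) := fun hn => hn.1 k h.1
  simp only [stateOf, h1, h2, or_false, fin_two_ite]

lemma stateOf_eq_init {ω : Config d} {τ : Clocks d} {σ : Coins d} {L : Site d → ℕ → Prop}
    {J : Set ℝ≥0} {x : Site d} (h : ∀ k, ¬ (τ x k ∈ J ∧ L x k)) :
    stateOf ω τ σ L J x = ω x := by
  have h1 : ¬ ∃ j, LastMarked τ L J x j ∧ σ x j = 1 := fun ⟨j, hj, _⟩ => h j hj.1
  simp only [stateOf, h1, false_or, fun k => iff_true_intro (h k), implies_true, true_and,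
    fin_two_ite]

/-- Finite-depth approximations of the set of legal rings. -/
def approxLegal (U : UpdateFamily d) (ω : Config d) (τ : Clocks d) (σ : Coins d) :
    ℕ → Site d → ℕ → Prop
  | 0 => fun _ _ => False
  | n + 1 => fun x k => U.Constraint x (stateOf ω τ σ (approxLegal U ω τ σ n) (Iio (τ x k)))

/-- The rings that are legal in all approximations of large depth. -/
def limitLegal (U : UpdateFamily d) (ω : Config d) (τ : Clocks d) (σ : Coins d)
    (x : Site d) (k : ℕ) : Prop :=
  ∃ N, ∀ n, N ≤ n → U.approxLegal ω τ σ n x k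

/-- The explicit candidate for the KCM trajectory. -/
noncomputable def flow (U : UpdateFamily d) (ω : Config d) (τ : Clocks d) (σ : Coins d)
    (t : ℝ≥0) : Config d :=
  stateOf ω τ σ (U.limitLegal ω τ σ) (Iic t)

/-- The ring `(y, j)` may directly influence the legality of the ring `(x, k)`. -/
def Influences (U : UpdateFamily d) (τ : Clocks d) (a b : Site d × ℕ) : Prop :=
  ∃ u ∈ U.displacements, a.1 = b.1 + u ∧ τ a.1 a.2 < τ b.1 b.2

/-- Clocks for which every site rings at increasing positive times without accumulation. -/
structure RegularClocks (τ : Clocks d) : Prop where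
  strictMono : ∀ x, StrictMono (τ x)
  pos : ∀ x, 0 < τ x 0
  tendsto : ∀ x, Tendsto (τ x) atTop atTop

namespace RegularClocks

variable {τ : Clocks d}

lemma ring_pos (hτ : RegularClocks τ) (x : Site d) (k : ℕ) : 0 < τ x k :=
  (hτ.pos x).trans_le ((hτ.strictMono x).monotone (Nat.zero_le k))

lemma finite_lt (hτ : RegularClocks τ) (x : Site d) (s : ℝ≥0) : {k | τ x k < s}.Finite := by
  obtain ⟨N, hN⟩ := ((hτ.tendsto x).eventually_ge_atTop s).exists_forall_of_atTop
  exact (finite_Iio N).subset fun k hk => not_le.1 fun h => (hN k h).not_gt hk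

lemma exists_lt_no_ring (hτ : RegularClocks τ) (x : Site d) {s : ℝ≥0} (hs : 0 < s) :
    ∃ m < s, ∀ k, τ x k < s → τ x k ≤ m := by
  -- The last ring before `s`; the empty supremum is `0`, which is below `s` by `hs`.
  refine ⟨(hτ.finite_lt x s).toFinset.sup (τ x), (Finset.sup_lt_iff hs).2 (by simp), ?_⟩
  exact fun k hk => Finset.le_sup (f := τ x) (by simpa using hk)

end RegularClocks

/-- Convergence is sitewise in the product topology, so `m` may depend on the site. Positivity of
`s` makes the left neighbourhood filter nontrivial, without which `Function.leftLim` returns a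
default value. -/
lemma leftLim_eq_of_forall_exists {η : ℝ≥0 → Config d} {s : ℝ≥0} (hs : 0 < s) {c : Config d}
    (h : ∀ x, ∃ m < s, ∀ t, m ≤ t → t < s → η t x = c x) : Function.leftLim η s = c := by
  have : (𝓝[<] s).NeBot := nhdsLT_neBot_of_exists_lt ⟨0, hs⟩
  refine leftLim_eq_of_tendsto (tendsto_pi_nhds.2 fun x => ?_)
  obtain ⟨m, hm, h⟩ := h x
  refine tendsto_const_nhds.congr' ?_
  filter_upwards [Ioo_mem_nhdsLT hm] with t ht
  exact (h t ht.1.le ht.2).symm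

lemma RegularClocks.leftLim_stateOf {τ : Clocks d} (hτ : RegularClocks τ) (ω : Config d)
    (σ : Coins d) (L : Site d → ℕ → Prop) {s : ℝ≥0} (hs : 0 < s) :
    Function.leftLim (fun t => stateOf ω τ σ L (Iic t)) s = stateOf ω τ σ L (Iio s) := by
  refine leftLim_eq_of_forall_exists hs fun x => ?_
  obtain ⟨m, hm, h⟩ := hτ.exists_lt_no_ring x hs
  refine ⟨m, hm, fun t hmt hts => stateOf_congr rfl rfl fun k => and_congr_left fun _ => ?_⟩
  exact ⟨fun hk => lt_of_le_of_lt hk hts, fun hk => (h k hk).trans hmt⟩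

/-- One half of the correspondence: every fixed point generates a trajectory. -/
lemma RegularClocks.isTrajectory_stateOf {τ : Clocks d} (hτ : RegularClocks τ)
    (U : UpdateFamily d) (ω : Config d) (σ : Coins d) {L : Site d → ℕ → Prop}
    (hL : ∀ x k, L x k ↔ U.Constraint x (stateOf ω τ σ L (Iio (τ x k)))) :
    U.IsTrajectory ω τ σ (fun t => stateOf ω τ σ L (Iic t)) where
  init := by
    funext x
    exact stateOf_eq_init fun k hk => (hτ.ring_pos x k).not_ge hk.1
  const x s t hst h := by
    refine stateOf_congr rfl rfl fun k => and_congr_left fun _ => ⟨fun hk => ?_, fun hk => hk.trans hst⟩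
    exact not_lt.1 fun hlt => h k ⟨hlt, hk⟩
  legal x k h := by
    rw [hτ.leftLim_stateOf ω σ L (hτ.ring_pos x k), ← hL] at h
    exact LastMarked.stateOf_eq ⟨⟨mem_Iic.2 le_rfl, h⟩, fun j hj hj' => (hτ.strictMono x hj).not_ge hj'.1⟩
  illegal x k h := by
    rw [hτ.leftLim_stateOf ω σ L (hτ.ring_pos x k)] at h ⊢
    rw [← hL] at h
    refine stateOf_congr rfl rfl fun j => and_congr_left fun hj => ?_
    refine ⟨fun hle => mem_Iio.2 <| lt_of_le_of_ne hle fun he => ?_, fun hlt => le_of_lt (mem_Iio.1 hlt)⟩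
    exact h ((hτ.strictMono x).injective he ▸ hj)

lemma IsTrajectory.leftLim_apply {U : UpdateFamily d} {ω : Config d} {τ : Clocks d} {σ : Coins d}
    {η : ℝ≥0 → Config d} (hη : U.IsTrajectory ω τ σ η) (hτ : RegularClocks τ) {s : ℝ≥0}
    (hs : 0 < s) (x : Site d) : ∃ m < s, (∀ k, τ x k < s → τ x k ≤ m) ∧
      Function.leftLim η s x = η m x := by
  choose m hm h using fun y => hτ.exists_lt_no_ring y hs
  refine ⟨m x, hm x, h x, ?_⟩
  rw [leftLim_eq_of_forall_exists hs (c := fun y => η (m y) y)]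
  refine fun y => ⟨m y, hm y, fun t h1 h2 => hη.const y _ _ h1 fun k hk => ?_⟩
  exact hk.1.not_ge (h y k (hk.2.trans_lt h2))

/-- The converse half: a trajectory is generated by its own legal rings. At a fixed site, induct on
the number of rings that have occurred; no well-foundedness is needed. -/
lemma IsTrajectory.eq_stateOf {U : UpdateFamily d} {ω : Config d} {τ : Clocks d} {σ : Coins d}
    {η : ℝ≥0 → Config d} (hη : U.IsTrajectory ω τ σ η) (hτ : RegularClocks τ) :
    η = fun t => stateOf ω τ σ
      (fun x k => U.Constraint x (Function.leftLim η (τ x k))) (Iic t) := by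
  funext t x
  set L : Site d → ℕ → Prop := fun x k => U.Constraint x (Function.leftLim η (τ x k)) with hLdef
  have key : ∀ k, ∀ t, t < τ x k → η t x = stateOf ω τ σ L (Iic t) x := by
    intro k
    induction k with
    | zero =>
      intro t ht
      have hno : ∀ k, ¬ τ x k ≤ t := fun k hk =>
        (ht.trans_le ((hτ.strictMono x).monotone (Nat.zero_le k))).not_ge hk
      rw [stateOf_eq_init fun k hk => hno k hk.1,
        hη.const x 0 t zero_le fun k hk => hno k hk.2, hη.init]
    | succ k ih =>
      intro t ht
      by_cases htk : t < τ x k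
      · exact ih t htk
      have htk' : τ x k ≤ t := not_lt.1 htk
      have hlt : ∀ j, τ x j ≤ t → j ≤ k := fun j hj =>
        Nat.lt_succ_iff.1 ((hτ.strictMono x).lt_iff_lt.1 (hj.trans_lt ht))
      rw [hη.const x _ t htk' fun j hj =>
        hj.1.not_ge ((hτ.strictMono x).monotone (hlt j hj.2))]
      by_cases hL : L x k
      · rw [hη.legal x k hL]
        exact (LastMarked.stateOf_eq
          ⟨⟨htk', hL⟩, fun j hj hj' => (hlt j hj'.1).not_gt hj⟩).symm
      · rw [hη.illegal x k hL]
        obtain ⟨m, hm, hm', he⟩ := hη.leftLim_apply hτ (hτ.ring_pos x k) x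
        rw [he, ih m hm]
        -- Ring `k` is unmarked, so the marked rings up to `t` all precede it and hence occur by
        -- time `m`.
        refine stateOf_congr rfl rfl fun j => and_congr_left fun hj => ?_
        refine ⟨fun hjm => le_trans hjm (hm.le.trans htk'), fun hjt => hm' j ?_⟩
        refine hτ.strictMono x (lt_of_le_of_ne (hlt j hjt) ?_)
        rintro rfl
        exact hL hj
  obtain ⟨k, hk⟩ := ((hτ.tendsto x).eventually_gt_atTop t).exists
  exact key k t hk

/-! ### Existence and uniqueness when influence is well-founded -/

section WellPosed

variable {U : UpdateFamily d} {τ : Clocks d}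

lemma constraint_stateOf_congr {ω : Config d} {σ : Coins d} {x : Site d} {k : ℕ}
    {L L' : Site d → ℕ → Prop} (h : ∀ p, U.Influences τ p (x, k) → (L p.1 p.2 ↔ L' p.1 p.2)) :
    U.Constraint x (stateOf ω τ σ L (Iio (τ x k))) ↔
      U.Constraint x (stateOf ω τ σ L' (Iio (τ x k))) :=
  U.constraint_congr fun u hu => stateOf_congr rfl rfl fun j =>
    and_congr_right fun hj => h (x + u, j) ⟨u, hu, rfl, hj⟩

lemma RegularClocks.finite_influences (hτ : RegularClocks τ) (p : Site d × ℕ) :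
    {a | U.Influences τ a p}.Finite := by
  refine (U.displacements.finite_toSet.biUnion fun u _ =>
    ((hτ.finite_lt (p.1 + u) (τ p.1 p.2)).image (Prod.mk (p.1 + u)))).subset ?_
  rintro ⟨y, j⟩ ⟨u, hu, hy, hlt⟩
  obtain rfl : y = p.1 + u := hy
  exact mem_biUnion hu ⟨j, hlt, rfl⟩

/-- Well-founded induction: a ring has finitely many direct influences, so once all of these have
stabilised the ring itself stabilises one depth later. -/
lemma RegularClocks.eventually_approxLegal (hτ : RegularClocks τ)
    (hwf : WellFounded (U.Influences τ)) (ω : Config d) (σ : Coins d) (p : Site d × ℕ) :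
    ∀ᶠ n in atTop, U.approxLegal ω τ σ n p.1 p.2 ↔
      U.Constraint p.1 (stateOf ω τ σ (U.limitLegal ω τ σ) (Iio (τ p.1 p.2))) := by
  induction p using hwf.induction with
  | _ p ih =>
  have ih' : ∀ a ∈ {a | U.Influences τ a p}, ∀ᶠ n in atTop,
      (U.approxLegal ω τ σ n a.1 a.2 ↔ U.limitLegal ω τ σ a.1 a.2) := by
    intro a ha
    have hl : U.limitLegal ω τ σ a.1 a.2 ↔ ∀ᶠ n in atTop, U.approxLegal ω τ σ n a.1 a.2 :=
      eventually_atTop.symm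
    have he := ih a ha
    have : U.limitLegal ω τ σ a.1 a.2 ↔
        U.Constraint a.1 (stateOf ω τ σ (U.limitLegal ω τ σ) (Iio (τ a.1 a.2))) := by
      -- The right-hand side of `he` does not depend on `n`, so being eventually legal is the same
      -- as that right-hand side.
      rw [hl, eventually_congr he, eventually_const]
    simpa only [this] using he
  have hev := ((hτ.finite_influences p).eventually_all).2 ih'
  obtain ⟨N, hN⟩ := eventually_atTop.1 hev
  refine eventually_atTop.2 ⟨N + 1, fun n hn => ?_⟩
  obtain ⟨m, rfl⟩ := Nat.exists_eq_add_of_le' hn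
  exact constraint_stateOf_congr (hN (m + N) (Nat.le_add_left N m))

lemma RegularClocks.limitLegal_iff (hτ : RegularClocks τ)
    (hwf : WellFounded (U.Influences τ)) (ω : Config d) (σ : Coins d) (x : Site d) (k : ℕ) :
    U.limitLegal ω τ σ x k ↔
      U.Constraint x (stateOf ω τ σ (U.limitLegal ω τ σ) (Iio (τ x k))) := by
  have hl : U.limitLegal ω τ σ x k ↔ ∀ᶠ n in atTop, U.approxLegal ω τ σ n x k :=
    eventually_atTop.symm
  rw [hl, eventually_congr (hτ.eventually_approxLegal hwf ω σ (x, k)), eventually_const]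

lemma eq_of_forall_constraint_iff (hwf : WellFounded (U.Influences τ)) {ω : Config d}
    {σ : Coins d} {L L' : Site d → ℕ → Prop}
    (hL : ∀ x k, L x k ↔ U.Constraint x (stateOf ω τ σ L (Iio (τ x k))))
    (hL' : ∀ x k, L' x k ↔ U.Constraint x (stateOf ω τ σ L' (Iio (τ x k)))) : L = L' := by
  suffices h : ∀ p : Site d × ℕ, L p.1 p.2 ↔ L' p.1 p.2 from
    funext₂ fun x k => propext (h (x, k))
  intro p
  induction p using hwf.induction with
  | _ p ih => rw [hL, hL', constraint_stateOf_congr ih]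

/-- The limit of the approximations is a fixed point, and the legal rings of any other trajectory
form a fixed point as well, so the two sets coincide. -/
lemma RegularClocks.existsUnique_isTrajectory (hτ : RegularClocks τ)
    (hwf : WellFounded (U.Influences τ)) (ω : Config d) (σ : Coins d) :
    U.IsTrajectory ω τ σ (U.flow ω τ σ) ∧ ∃! η, U.IsTrajectory ω τ σ η := by
  have hL := hτ.limitLegal_iff hwf ω σ
  have hflow : U.IsTrajectory ω τ σ (U.flow ω τ σ) := hτ.isTrajectory_stateOf U ω σ hL
  refine ⟨hflow, U.flow ω τ σ, hflow, fun η hη => ?_⟩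
  have he := hη.eq_stateOf hτ
  rw [he]
  unfold flow
  rw [eq_of_forall_constraint_iff hwf hL (L' := fun x k =>
    U.Constraint x (Function.leftLim η (τ x k)))]
  intro x k
  rw [← hτ.leftLim_stateOf ω σ _ (hτ.ring_pos x k), ← he]

lemma RegularClocks.kcm_eq_flow (hτ : RegularClocks τ)
    (hwf : WellFounded (U.Influences τ)) (ω : Config d) (σ : Coins d) :
    U.kcm ω τ σ = U.flow ω τ σ := by
  obtain ⟨h, hu⟩ := hτ.existsUnique_isTrajectory hwf ω σ
  rw [kcm, dif_pos hu]
  exact hu.unique hu.choose_spec.1 h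

lemma RegularClocks.legalUpdateBy_iff (hτ : RegularClocks τ)
    (hwf : WellFounded (U.Influences τ)) (ω : Config d) (σ : Coins d) (x : Site d) (t : ℝ≥0) :
    U.LegalUpdateBy ω τ σ x t ↔ ∃ k, τ x k ≤ t ∧ U.limitLegal ω τ σ x k := by
  refine exists_congr fun k => and_congr_right fun _ => ?_
  rw [hτ.kcm_eq_flow hwf, hτ.limitLegal_iff hwf]
  unfold flow
  rw [hτ.leftLim_stateOf ω σ _ (hτ.ring_pos x k)]

lemma RegularClocks.exists_lastMarked (hτ : RegularClocks τ) {L : Site d → ℕ → Prop} {x : Site d}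
    {t : ℝ≥0} (h : ∃ k, τ x k ≤ t ∧ L x k) : ∃ k, LastMarked τ L (Iic t) x k := by
  have hfin : {k | τ x k ∈ Iic t ∧ L x k}.Finite :=
    (hτ.finite_lt x (t + 1)).subset fun k hk => (mem_Iic.1 hk.1).trans_lt (by simp)
  obtain ⟨k, hk, hmax⟩ := hfin.exists_maximal h
  exact ⟨k, hk, fun j hj hj' => hj.not_ge (hmax hj' hj.le)⟩

end WellPosed

/-! ### Dependence on the data in a set closed under displacements -/

section Locality

/-- The site `x` may lie outside `A`: only its clock and its displaced sites matter for legality,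
not its own coins or initial value. This is what later separates legality at `x` from the coins at
`x`. No regularity of the clocks is assumed. -/
lemma approxLegal_congr {U : UpdateFamily d} {ω ω' : Config d} {τ τ' : Clocks d}
    {σ σ' : Coins d} {A : Set (Site d)}
    (hA : ∀ y ∈ A, ∀ u ∈ U.displacements, y + u ∈ A)
    (hω : ∀ y ∈ A, ω y = ω' y) (hτ : ∀ y ∈ A, τ y = τ' y) (hσ : ∀ y ∈ A, σ y = σ' y)
    (n : ℕ) {x : Site d} (hx : τ x = τ' x) (hxA : ∀ u ∈ U.displacements, x + u ∈ A) (k : ℕ) :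
    U.approxLegal ω τ σ n x k ↔ U.approxLegal ω' τ' σ' n x k := by
  induction n generalizing x k with
  | zero => rfl
  | succ n ih =>
    simp only [approxLegal, hx]
    refine U.constraint_congr fun u hu => ?_
    have hu' := hxA u hu
    refine stateOf_congr (hω _ hu') (hσ _ hu') fun j => ?_
    rw [hτ _ hu', ih (hτ _ hu') (hA _ hu')]

lemma limitLegal_congr {U : UpdateFamily d} {ω ω' : Config d} {τ τ' : Clocks d}
    {σ σ' : Coins d} {A : Set (Site d)}
    (hA : ∀ y ∈ A, ∀ u ∈ U.displacements, y + u ∈ A)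
    (hω : ∀ y ∈ A, ω y = ω' y) (hτ : ∀ y ∈ A, τ y = τ' y) (hσ : ∀ y ∈ A, σ y = σ' y)
    {x : Site d} (hx : τ x = τ' x) (hxA : ∀ u ∈ U.displacements, x + u ∈ A) (k : ℕ) :
    U.limitLegal ω τ σ x k ↔ U.limitLegal ω' τ' σ' x k :=
  exists_congr fun _ => forall₂_congr fun n _ => approxLegal_congr hA hω hτ hσ n hx hxA k

lemma flow_congr {U : UpdateFamily d} {ω ω' : Config d} {τ τ' : Clocks d}
    {σ σ' : Coins d} {A : Set (Site d)}
    (hA : ∀ y ∈ A, ∀ u ∈ U.displacements, y + u ∈ A)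
    (hω : ∀ y ∈ A, ω y = ω' y) (hτ : ∀ y ∈ A, τ y = τ' y) (hσ : ∀ y ∈ A, σ y = σ' y)
    {x : Site d} (hx : x ∈ A) (t : ℝ≥0) : U.flow ω τ σ t x = U.flow ω' τ' σ' t x := by
  refine stateOf_congr (hω x hx) (hσ x hx) fun k => ?_
  rw [limitLegal_congr hA hω hτ hσ (hτ x hx) (hA x hx), hτ x hx]

end Locality

/-! ### Measurability of the flow -/

section Measurability

/-- Initial condition, clocks and coins. -/
abbrev Data (d : ℕ) := Config d × Clocks d × Coins d

lemma measurable_ring (x : Site d) (k : ℕ) : Measurable fun z : Data d => z.2.1 x k :=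
  (measurable_pi_apply k).comp ((measurable_pi_apply x).comp measurable_snd.fst)

lemma measurable_coin (x : Site d) (k : ℕ) : Measurable fun z : Data d => z.2.2 x k :=
  (measurable_pi_apply k).comp ((measurable_pi_apply x).comp measurable_snd.snd)

lemma measurable_lastMarked {L : Data d → Site d → ℕ → Prop} {J : Data d → Set ℝ≥0} {x : Site d}
    (hL : ∀ k, Measurable fun z => L z x k) (hJ : ∀ k, Measurable fun z => z.2.1 x k ∈ J z)
    (k : ℕ) : Measurable fun z => LastMarked z.2.1 (L z) (J z) x k :=
  ((hJ k).and (hL k)).and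
    (.forall fun j => .imp measurable_const (((hJ j).and (hL j)).not))

lemma measurable_stateOf {L : Data d → Site d → ℕ → Prop} {J : Data d → Set ℝ≥0} {x : Site d}
    (hL : ∀ k, Measurable fun z => L z x k) (hJ : ∀ k, Measurable fun z => z.2.1 x k ∈ J z) :
    Measurable fun z : Data d => stateOf z.1 z.2.1 z.2.2 (L z) (J z) x := by
  refine Measurable.ite (measurableSet_setOfPred.2 (.or (.exists fun k => .and
    (measurable_lastMarked hL hJ k) ?_) (.and (.forall fun k => ((hJ k).and (hL k)).not) ?_)))
    measurable_const measurable_const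
  · exact measurableSet_setOfPred.1 (measurable_coin x k (measurableSet_singleton 1))
  · exact measurableSet_setOfPred.1
      (((measurable_pi_apply x).comp measurable_fst) (measurableSet_singleton 1))

lemma measurable_constraint (U : UpdateFamily d) {x : Site d} {c : Data d → Config d}
    (hc : ∀ y, Measurable fun z => c z y) : Measurable fun z => U.Constraint x (c z) := by
  have : (fun z => U.Constraint x (c z)) =
      fun z => ∃ R : U.rules, ∀ u : R.1, c z (x + u.1) = 0 := by
    simp [Constraint]
  rw [this]
  exact .exists fun R => .forall fun u =>
    measurableSet_setOfPred.1 (hc (x + u.1) (measurableSet_singleton 0))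

lemma measurable_approxLegal (U : UpdateFamily d) (n : ℕ) (x : Site d) (k : ℕ) :
    Measurable fun z : Data d => U.approxLegal z.1 z.2.1 z.2.2 n x k := by
  induction n generalizing x k with
  | zero => exact measurable_const
  | succ n ih =>
    exact U.measurable_constraint fun y => measurable_stateOf (ih y) fun j =>
      measurableSet_setOfPred.1 (measurableSet_lt (measurable_ring y j) (measurable_ring x k))

/-- Being a countable combination of finite-depth events, the limit is measurable on all data,
including data where no unique trajectory exists; a definition by well-founded recursion would not
give this directly. -/
lemma measurable_limitLegal (U : UpdateFamily d) (x : Site d) (k : ℕ) :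
    Measurable fun z : Data d => U.limitLegal z.1 z.2.1 z.2.2 x k :=
  .exists fun _ => .forall fun n => .imp measurable_const (U.measurable_approxLegal n x k)

lemma measurable_ring_le (x : Site d) (t : ℝ≥0) (k : ℕ) :
    Measurable fun z : Data d => z.2.1 x k ∈ Iic t :=
  measurableSet_setOfPred.1 (measurable_ring x k measurableSet_Iic)

lemma measurable_flow (U : UpdateFamily d) (t : ℝ≥0) (x : Site d) :
    Measurable fun z : Data d => U.flow z.1 z.2.1 z.2.2 t x :=
  measurable_stateOf (U.measurable_limitLegal x) (measurable_ring_le x t)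

end Measurability

end UpdateFamily

/-! ### General facts on independence -/

section Independence

variable {Ω : Type*} {mΩ : MeasurableSpace Ω} {P : Measure Ω}

/-- Regroups independence between kinds of data into independence between regions. It suffices to
factor the probabilities of rectangles, which form generating π-systems. -/
lemma indepFun_prodMk_prodMk {α₁ α₂ β₁ β₂ : Type*} [MeasurableSpace α₁] [MeasurableSpace α₂]
    [MeasurableSpace β₁] [MeasurableSpace β₂] [IsProbabilityMeasure P]
    {X₁ : Ω → α₁} {X₂ : Ω → α₂} {Y₁ : Ω → β₁} {Y₂ : Ω → β₂}
    (mX₁ : Measurable X₁) (mX₂ : Measurable X₂) (mY₁ : Measurable Y₁) (mY₂ : Measurable Y₂)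
    (hX : IndepFun X₁ X₂ P) (hY : IndepFun Y₁ Y₂ P)
    (h : IndepFun (fun w => (X₁ w, X₂ w)) (fun w => (Y₁ w, Y₂ w)) P) :
    IndepFun (fun w => (X₁ w, Y₁ w)) (fun w => (X₂ w, Y₂ w)) P := by
  have h1 : IndepFun X₁ Y₁ P := h.comp measurable_fst measurable_fst
  have h2 : IndepFun X₂ Y₂ P := h.comp measurable_snd measurable_snd
  refine IndepSets.indep (mX₁.prodMk mY₁).comap_le (mX₂.prodMk mY₂).comap_le
    (isPiSystem_prod.comap _) (isPiSystem_prod.comap _)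
    (by rw [← generateFrom_prod, MeasurableSpace.comap_generateFrom]; rfl)
    (by rw [← generateFrom_prod, MeasurableSpace.comap_generateFrom]; rfl) ?_
  rw [IndepSets_iff]
  rintro _ _ ⟨_, ⟨s, hs, t, ht, rfl⟩, rfl⟩ ⟨_, ⟨s', hs', t', ht', rfl⟩, rfl⟩
  have e := h.measure_inter_preimage_eq_mul (s ×ˢ s') (t ×ˢ t') (hs.prod hs') (ht.prod ht')
  have e1 := h1.measure_inter_preimage_eq_mul s t hs ht
  have e2 := h2.measure_inter_preimage_eq_mul s' t' hs' ht'
  have e3 := hX.measure_inter_preimage_eq_mul s s' hs hs'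
  have e4 := hY.measure_inter_preimage_eq_mul t t' ht ht'
  simp only [Set.mk_preimage_prod] at e ⊢
  rw [Set.inter_inter_inter_comm, e, e1, e2, e3, e4]
  ring

lemma indepFun_of_disjoint {ι : Type*} {β : ι → Type*} {mβ : ∀ i, MeasurableSpace (β i)}
    {f : ∀ i, Ω → β i} (mf : ∀ i, Measurable (f i)) (hf : iIndepFun f P) {A B : Set ι}
    (hAB : Disjoint A B) :
    IndepFun (fun w (i : A) => f i w) (fun w (i : B) => f i w) P := by
  have key : ∀ C : Set ι, MeasurableSpace.comap (fun w (i : C) => f i w) MeasurableSpace.pi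
      = ⨆ i ∈ C, MeasurableSpace.comap (f i) (mβ i) := by
    intro C
    simp only [MeasurableSpace.pi, MeasurableSpace.comap_iSup, MeasurableSpace.comap_comp]
    rw [iSup_subtype']
    rfl
  unfold IndepFun
  have := indep_iSup_of_disjoint (fun i => (mf i).comap_le) hf hAB
  rw [← key, ← key] at this
  exact this

/-- The joint law is an infinite product, and currying turns a product over pairs into a product of
the row products. -/
lemma iIndepFun_rows {ι κ E : Type*} [MeasurableSpace E] [IsProbabilityMeasure P]
    {X : ι → κ → Ω → E} (mX : ∀ i j, Measurable (X i j))
    (h : iIndepFun (fun p : ι × κ => X p.1 p.2) P) :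
    iIndepFun (fun i w j => X i j w) P := by
  have hprob : ∀ i j, IsProbabilityMeasure (P.map (X i j)) :=
    fun i j => Measure.isProbabilityMeasure_map (mX i j).aemeasurable
  rw [iIndepFun_iff_map_fun_eq_infinitePi_map (by fun_prop)]
  have hrow : ∀ i, P.map (fun w j => X i j w) = Measure.infinitePi fun j => P.map (X i j) :=
    fun i => (iIndepFun_iff_map_fun_eq_infinitePi_map (mX i)).1
      (iIndepFun.precomp (f := fun p : ι × κ => X p.1 p.2) (g := Prod.mk i)
        (Prod.mk_right_injective i) h)
  simp only [hrow]
  rw [← Measure.infinitePi_map_curry (fun i j => P.map (X i j)),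
    ← (iIndepFun_iff_map_fun_eq_infinitePi_map (X := fun p : ι × κ => X p.1 p.2)
      (fun p => mX p.1 p.2)).1 h, Measure.map_map (by fun_prop) (by fun_prop)]
  rfl

/-- By Fubini: for each value `x` of `X`, the section is the single point `a - x`, which is null for
`Y`. -/
lemma indepFun_measure_add_eq_zero [IsProbabilityMeasure P] {X Y : Ω → ℝ} (mX : Measurable X)
    (mY : Measurable Y) (h : IndepFun X Y P) (hY : ∀ a, P.map Y {a} = 0) (a : ℝ) :
    P {w | X w + Y w = a} = 0 := by
  have hs : MeasurableSet {p : ℝ × ℝ | p.1 + p.2 = a} :=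
    (measurable_fst.add measurable_snd) (measurableSet_singleton a)
  have := Measure.isProbabilityMeasure_map (μ := P) mY.aemeasurable
  have h0 : (P.map fun w => (X w, Y w)) {p : ℝ × ℝ | p.1 + p.2 = a} = 0 := by
    rw [(indepFun_iff_map_prod_eq_prod_map_map mX.aemeasurable mY.aemeasurable).1 h,
      Measure.measure_prod_null hs]
    refine Filter.Eventually.of_forall fun x => ?_
    convert! hY (a - x) using 2
    ext y
    simp [eq_sub_iff_add_eq']
  rwa [Measure.map_apply (mX.prodMk mY) hs] at h0

end Independence

/-! ### A single Poisson clock -/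

section SingleClock

open Filter Topology Set

instance : IsProbabilityMeasure (expMeasure 1) := isProbabilityMeasure_expMeasure one_pos

/-- The law of the sequence of waiting times of a rate-one Poisson clock. -/
noncomputable def waitingLaw : Measure (ℕ → ℝ) := Measure.infinitePi fun _ => expMeasure 1

instance : IsProbabilityMeasure waitingLaw := by unfold waitingLaw; infer_instance

lemma expMeasure_singleton (a : ℝ) : expMeasure 1 {a} = 0 :=
  withDensity_absolutelyContinuous _ _ (measure_singleton a)

lemma expMeasure_Iic (a : ℝ) :
    expMeasure 1 (Iic a) = ENNReal.ofReal (if 0 ≤ a then 1 - Real.exp (-a) else 0) := by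
  rw [← ofReal_cdf, cdf_expMeasure_eq one_pos, one_mul]

lemma ae_waitingLaw_pos : ∀ᵐ s ∂waitingLaw, ∀ k, 0 < s k := by
  refine ae_all_iff.2 fun k => ?_
  have h : ∀ᵐ r ∂(expMeasure 1), 0 < r := by
    rw [ae_iff]
    simpa [Iic_def] using expMeasure_Iic 0
  exact (measurePreserving_eval_infinitePi (fun _ : ℕ => expMeasure 1) k).quasiMeasurePreserving.ae h

/-- The ring times with given waiting times. -/
def ringTime (s : ℕ → ℝ) (k : ℕ) : ℝ := ∑ j ∈ Finset.range (k + 1), s j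

lemma measurable_ringTime (k : ℕ) : Measurable fun s => ringTime s k := by
  unfold ringTime; fun_prop

/-- If all ring times stayed below `N`, so would all the positive waiting times; `n` independent
ones do so with probability `c ^ n` for a constant `c < 1`. -/
lemma ae_waitingLaw_unbounded : ∀ᵐ s ∂waitingLaw, ∀ N : ℕ, ∃ k, (N : ℝ) < ringTime s k := by
  refine ae_all_iff.2 fun N => ?_
  have hlt : expMeasure 1 (Iic (N : ℝ)) < 1 := by
    rw [expMeasure_Iic, if_pos N.cast_nonneg, ENNReal.ofReal_lt_one]
    linarith [Real.exp_pos (-(N : ℝ))]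
  have hnull : waitingLaw {s | ∀ j, s j ≤ N} = 0 := by
    refine le_antisymm (ge_of_tendsto' (ENNReal.tendsto_pow_atTop_nhds_zero_of_lt_one hlt)
      fun n => ?_) (zero_le)
    calc waitingLaw {s | ∀ j, s j ≤ N}
        ≤ waitingLaw ((Finset.range n : Set ℕ).pi fun _ => Iic (N : ℝ)) :=
          measure_mono fun s hs j _ => hs j
      _ = expMeasure 1 (Iic (N : ℝ)) ^ n := by
          rw [waitingLaw, Measure.infinitePi_pi _ fun _ _ => measurableSet_Iic]
          simp
  have hnull' : ∀ᵐ s ∂waitingLaw, ¬ ∀ j, s j ≤ (N : ℝ) := by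
    rw [ae_iff]; simpa using hnull
  filter_upwards [ae_waitingLaw_pos, hnull'] with s hs hN
  by_contra! hle
  refine hN fun j => le_trans ?_ (hle j)
  exact Finset.single_le_sum (fun i _ => (hs i).le) (Finset.self_mem_range_succ j)

lemma ae_waitingLaw_ringTime_ne (a : ℝ) : ∀ᵐ s ∂waitingLaw, ∀ k, ringTime s k ≠ a := by
  refine ae_all_iff.2 fun k => ?_
  have hind : iIndepFun (fun (j : ℕ) (s : ℕ → ℝ) => s j) waitingLaw :=
    iIndepFun_infinitePi (X := fun _ x => x) fun _ => measurable_id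
  have h := hind.indepFun_finsetSum_of_notMem (fun j => measurable_pi_apply j)
    (s := Finset.range k) (i := k) (by simp)
  rw [ae_iff]
  have h0 := indepFun_measure_add_eq_zero (by fun_prop) (measurable_pi_apply k) h (fun b => by
    rw [waitingLaw, Measure.infinitePi_map_eval, expMeasure_singleton]) a
  simpa [ringTime, Finset.sum_range_succ] using h0

/-- The waiting times for which the clock rings during `I`. -/
def ringsIn (I : Set ℝ) : Set (ℕ → ℝ) := {s | ∃ k, ringTime s k ∈ I}

lemma measurableSet_ringsIn {I : Set ℝ} (hI : MeasurableSet I) : MeasurableSet (ringsIn I) := by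
  have : ringsIn I = ⋃ k, (fun s => ringTime s k) ⁻¹' I := by ext; simp [ringsIn]
  rw [this]
  exact .iUnion fun k => measurable_ringTime k hI

lemma strictMono_ringTime {s : ℕ → ℝ} (hs : ∀ k, 0 < s k) : StrictMono (ringTime s) :=
  strictMono_nat_of_lt_succ fun k => by
    rw [ringTime, ringTime, Finset.sum_range_succ _ (k + 1)]
    exact lt_add_of_pos_right _ (hs _)

lemma tendsto_ringTime {s : ℕ → ℝ} (hs : ∀ k, 0 < s k) (h : ∀ N : ℕ, ∃ k, (N : ℝ) < ringTime s k) :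
    Tendsto (ringTime s) atTop atTop :=
  tendsto_atTop_atTop_of_monotone (strictMono_ringTime hs).monotone fun b => by
    obtain ⟨N, hN⟩ := exists_nat_ge b
    obtain ⟨k, hk⟩ := h N
    exact ⟨k, hN.trans hk.le⟩

/-- Continuity from above: almost surely the ring times are locally finite and avoid `a`, so they
avoid a whole neighbourhood of `a`. -/
lemma exists_ball_ringsIn_lt (a : ℝ) {ε : ℝ≥0∞} (hε : 0 < ε) :
    ∃ δ > 0, waitingLaw (ringsIn (Metric.ball a δ)) < ε := by
  have hlim := tendsto_measure_iInter_atTop (μ := waitingLaw)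
    (s := fun n : ℕ => ringsIn (Metric.ball a (1 / ((n : ℝ) + 1))))
    (fun n => (measurableSet_ringsIn Metric.isOpen_ball.measurableSet).nullMeasurableSet)
    (fun m n hmn s ⟨k, hk⟩ => ⟨k, Metric.ball_subset_ball (Nat.one_div_le_one_div hmn) hk⟩)
    ⟨0, measure_ne_top _ _⟩
  have h0 : waitingLaw (⋂ n : ℕ, ringsIn (Metric.ball a (1 / ((n : ℝ) + 1)))) = 0 := by
    have : ∀ᵐ s ∂waitingLaw, s ∉ ⋂ n : ℕ, ringsIn (Metric.ball a (1 / ((n : ℝ) + 1))) := by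
      filter_upwards [ae_waitingLaw_pos, ae_waitingLaw_unbounded, ae_waitingLaw_ringTime_ne a]
        with s hs hN hne hmem
      obtain ⟨K, hK⟩ := eventually_atTop.1
        ((tendsto_ringTime hs hN).eventually_gt_atTop (a + 1))
      have hfin : IsClosed (ringTime s '' Iio K) := ((finite_Iio K).image _).isClosed
      have hnhds : (ringTime s '' Iio K)ᶜ ∩ Iio (a + 1) ∈ 𝓝 a := inter_mem
        (hfin.isOpen_compl.mem_nhds fun ⟨k, _, hk⟩ => hne k hk) (Iio_mem_nhds (lt_add_one a))
      obtain ⟨r, hr, hball⟩ := Metric.mem_nhds_iff.1 hnhds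
      obtain ⟨n, hn⟩ := exists_nat_one_div_lt hr
      obtain ⟨k, hk⟩ := mem_iInter.1 hmem n
      obtain ⟨h1, h2⟩ := hball (Metric.ball_subset_ball hn.le hk)
      exact h1 ⟨k, not_le.1 fun hKk => (hK k hKk).not_gt h2, rfl⟩
    exact measure_eq_zero_iff_ae_notMem.2 this
  rw [h0] at hlim
  obtain ⟨n, hn⟩ := (hlim.eventually (gt_mem_nhds hε)).exists
  exact ⟨_, Nat.one_div_pos_of_nat, hn⟩

end SingleClock

/-! ### Almost sure regularity of the clocks and absence of infinite influence chains -/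

section GraphicalConstruction

open Filter Topology Set

variable {d : ℕ}

lemma measurable_waitingTime (x : Site d) (k : ℕ) :
    Measurable fun τ : Clocks d => waitingTime τ x k := by
  have h : ∀ k, Measurable fun τ : Clocks d => (τ x k : ℝ) := fun k => by fun_prop
  cases k with
  | zero => exact h 0
  | succ k => exact (h (k + 1)).sub (h k)

lemma ringTime_waitingTime (τ : Clocks d) (x : Site d) (k : ℕ) :
    ringTime (waitingTime τ x) k = τ x k := by
  induction k with
  | zero => simp [ringTime, waitingTime]
  | succ k ih =>
    rw [ringTime, Finset.sum_range_succ, ← ringTime, ih]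
    simp [waitingTime]

/-- The clock at `x` rings during `I`. -/
def rings {Ω : Type*} (T : Ω → Clocks d) (I : Set ℝ) (x : Site d) : Set Ω := {w | ∃ k, (T w x k : ℝ) ∈ I}

lemma rings_eq {Ω : Type*} (T : Ω → Clocks d) (I : Set ℝ) (x : Site d) :
    rings T I x = (fun w => waitingTime (T w) x) ⁻¹' ringsIn I := by
  ext w
  simp [rings, ringsIn, ringTime_waitingTime]

/-- The `i`-th site of the path from `x` with steps `u`. -/
def pathSite (x : Site d) (u : ℕ → Site d) (i : ℕ) : Site d := x + ∑ j ∈ Finset.range i, u j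

lemma pathSite_succ (x : Site d) (u : ℕ → Site d) (i : ℕ) :
    pathSite x u (i + 1) = pathSite x u i + u i := by
  rw [pathSite, pathSite, Finset.sum_range_succ, add_assoc]

lemma pathSite_congr {x : Site d} {u u' : ℕ → Site d} {i : ℕ} (h : ∀ j < i, u j = u' j) :
    pathSite x u i = pathSite x u' i := by
  rw [pathSite, pathSite, Finset.sum_congr rfl fun j hj => h j (Finset.mem_range.1 hj)]

/-- The coordinate of a site in the direction `v`. -/
def height (v : Fin d → ℝ) (x : Site d) : ℝ := (fun i => (x i : ℝ)) ⬝ᵥ v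

lemma height_add (v : Fin d → ℝ) (x y : Site d) : height v (x + y) = height v x + height v y := by
  simp only [height, dotProduct, ← Finset.sum_add_distrib]
  exact Finset.sum_congr rfl fun i _ => by simp [add_mul]

lemma mem_siteHalfSpace {v : Fin d → ℝ} {x y : Site d} :
    y ∈ siteHalfSpace v x ↔ height v y < height v x := by
  have : (fun i => (y i : ℝ) - (x i : ℝ)) ⬝ᵥ v = height v y - height v x := by
    simp only [height, dotProduct, ← Finset.sum_sub_distrib, sub_mul]
  simp only [siteHalfSpace, halfSpace, mem_ofPred_eq, this, sub_neg]

lemma UpdateFamily.ContainedIn.height_neg {U : UpdateFamily d} {v : Fin d → ℝ}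
    (h : U.ContainedIn v) {u : Site d} (hu : u ∈ U.displacements) : height v u < 0 := by
  obtain ⟨R, hR, huR⟩ := Finset.mem_biUnion.1 hu
  exact h R hR u huR

lemma UpdateFamily.ContainedIn.height_add_lt {U : UpdateFamily d} {v : Fin d → ℝ}
    (h : U.ContainedIn v) (x : Site d) {u : Site d} (hu : u ∈ U.displacements) :
    height v (x + u) < height v x := by
  rw [height_add]
  linarith [h.height_neg hu]

lemma UpdateFamily.ContainedIn.add_mem_siteHalfSpace {U : UpdateFamily d} {v : Fin d → ℝ}
    (h : U.ContainedIn v) (x : Site d) (y : Site d) (hy : y ∈ siteHalfSpace v x) (u : Site d)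
    (hu : u ∈ U.displacements) : y + u ∈ siteHalfSpace v x :=
  mem_siteHalfSpace.2 ((h.height_add_lt y hu).trans (mem_siteHalfSpace.1 hy))

namespace IsGraphical

variable {Ω : Type*} [MeasurableSpace Ω] {P : Measure Ω} {q : ℝ}
  {T : Ω → Clocks d} {S : Ω → Coins d}

lemma measurable_waiting (hG : IsGraphical P q T S) (x : Site d) (k : ℕ) :
    Measurable fun w => waitingTime (T w) x k :=
  (measurable_waitingTime x k).comp hG.measurable_clocks

lemma iIndepFun_waitingTimes [IsProbabilityMeasure P] (hG : IsGraphical P q T S) :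
    iIndepFun (fun x w => waitingTime (T w) x) P :=
  iIndepFun_rows (X := fun x k w => waitingTime (T w) x k) hG.measurable_waiting
    hG.indep_waitingTime

lemma measurable_waitingTimes (hG : IsGraphical P q T S) (x : Site d) :
    Measurable fun w => waitingTime (T w) x :=
  measurable_pi_iff.2 (hG.measurable_waiting x)

lemma map_waitingTimes [IsProbabilityMeasure P] (hG : IsGraphical P q T S) (x : Site d) :
    P.map (fun w => waitingTime (T w) x) = waitingLaw := by
  have h := (iIndepFun_iff_map_fun_eq_infinitePi_map (hG.measurable_waiting x)).1
    (iIndepFun.precomp (f := fun (p : Site d × ℕ) w => waitingTime (T w) p.1 p.2) (g := Prod.mk x)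
      (Prod.mk_right_injective x) hG.indep_waitingTime)
  simp only [hG.waitingTime_law] at h
  exact h

lemma ae_regularClocks [IsProbabilityMeasure P] (hG : IsGraphical P q T S) :
    ∀ᵐ w ∂P, UpdateFamily.RegularClocks (T w) := by
  have h : ∀ᵐ w ∂P, ∀ x, (∀ k, 0 < waitingTime (T w) x k) ∧
      ∀ N : ℕ, ∃ k, (N : ℝ) < ringTime (waitingTime (T w) x) k := by
    refine ae_all_iff.2 fun x => ?_
    have := ae_waitingLaw_pos.and ae_waitingLaw_unbounded
    rw [← hG.map_waitingTimes x] at this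
    exact ae_of_ae_map (hG.measurable_waitingTimes x).aemeasurable this
  filter_upwards [h] with w hw
  have he : ∀ x, ringTime (waitingTime (T w) x) = fun k => (T w x k : ℝ) :=
    fun x => funext (ringTime_waitingTime (T w) x)
  refine ⟨fun x i j hij => ?_, fun x => ?_, fun x => ?_⟩
  · have := strictMono_ringTime (hw x).1 hij
    simp only [ringTime_waitingTime] at this
    exact_mod_cast this
  · have := (hw x).1 0
    simpa [waitingTime] using this
  · have := tendsto_ringTime (hw x).1 (hw x).2
    rw [he] at this
    exact NNReal.tendsto_coe_atTop.1 this

lemma measure_iInter_rings [IsProbabilityMeasure P] (hG : IsGraphical P q T S) {I : Set ℝ} (hI : MeasurableSet I) {n : ℕ}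
    {y : Fin n → Site d} (hy : Function.Injective y) :
    P (⋂ i, rings T I (y i)) = waitingLaw (ringsIn I) ^ n := by
  have hm := measurableSet_ringsIn hI
  have h := (hG.iIndepFun_waitingTimes.precomp hy).measure_inter_preimage_eq_mul Finset.univ
    (sets := fun _ => ringsIn I) fun _ _ => hm
  simp only [Finset.mem_univ, iInter_true] at h
  simp only [rings_eq]
  rw [h]
  have : ∀ x, P ((fun w => waitingTime (T w) x) ⁻¹' ringsIn I) = waitingLaw (ringsIn I) := by
    intro x
    rw [← Measure.map_apply (hG.measurable_waitingTimes x) hm, hG.map_waitingTimes]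
  simp [this]

variable {U : UpdateFamily d}

/-- Union bound over step sequences. Heights strictly decrease along a path, so its `n` sites are
distinct and their clocks independent. -/
lemma measure_exists_path_le [IsProbabilityMeasure P] (hG : IsGraphical P q T S)
    (hU : U.IsOriented) {I : Set ℝ} (hI : MeasurableSet I) (x : Site d) (n : ℕ) :
    P {w | ∃ u : ℕ → Site d, (∀ i, u i ∈ U.displacements) ∧ ∀ i < n, w ∈ rings T I (pathSite x u i)}
      ≤ (U.displacements.card * waitingLaw (ringsIn I)) ^ n := by
  obtain ⟨v, -, hv⟩ := hU
  -- Only sites of index below `n` are inspected, so the value `0` is never used. The last of the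
  -- `n` steps is not used either; counting it only enlarges the bound.
  let ext (u : Fin n → U.displacements) (j : ℕ) : Site d := if h : j < n then u ⟨j, h⟩ else 0
  have hinj : ∀ u : Fin n → U.displacements,
      Function.Injective fun i : Fin n => pathSite x (ext u) i := by
    intro u
    have hanti : StrictAntiOn (fun i => height v (pathSite x (ext u) i)) (Iic n) := by
      refine strictAntiOn_Iic_of_succ_lt fun i hi => ?_
      rw [Nat.succ_eq_succ, Nat.succ_eq_add_one, pathSite_succ]
      refine hv.height_add_lt _ ?_
      simp only [ext, dif_pos hi, Finset.coe_mem]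
    exact fun i j hij => Fin.ext (hanti.injOn i.2.le j.2.le (congrArg (height v) hij))
  calc _ ≤ P (⋃ u : Fin n → U.displacements, ⋂ i : Fin n, rings T I (pathSite x (ext u) i)) := by
        refine measure_mono fun w ⟨u, hu, hw⟩ => mem_iUnion.2
          ⟨fun i => ⟨u i, hu i⟩, mem_iInter.2 fun i => ?_⟩
        rw [pathSite_congr (u' := u)]
        · exact hw i i.2
        · exact fun j hj => by simp only [ext, dif_pos (hj.trans i.2)]
    _ ≤ ∑ u : Fin n → U.displacements, P (⋂ i : Fin n, rings T I (pathSite x (ext u) i)) :=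
        measure_iUnion_fintype_le _ _
    _ = (U.displacements.card * waitingLaw (ringsIn I)) ^ n := by
        simp only [hG.measure_iInter_rings hI (hinj _), Finset.sum_const, Finset.card_univ,
          Fintype.card_pi, Fintype.card_coe, Finset.prod_const, Fintype.card_fin, nsmul_eq_mul,
          Nat.cast_pow, mul_pow]

lemma ae_no_infinite_path [IsProbabilityMeasure P] (hG : IsGraphical P q T S)
    (hU : U.IsOriented) {I : Set ℝ} (hI : MeasurableSet I)
    (hlt : U.displacements.card * waitingLaw (ringsIn I) < 1) :
    ∀ᵐ w ∂P, ∀ x, ¬ ∃ u : ℕ → Site d, (∀ i, u i ∈ U.displacements) ∧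
      ∀ i, w ∈ rings T I (pathSite x u i) := by
  refine ae_all_iff.2 fun x => ?_
  rw [ae_iff]
  simp only [not_not]
  refine le_antisymm (ge_of_tendsto' (ENNReal.tendsto_pow_atTop_nhds_zero_of_lt_one hlt)
    fun n => ?_) zero_le
  refine (measure_mono ?_).trans (hG.measure_exists_path_le hU hI x n)
  exact fun w ⟨u, hu, hw⟩ => ⟨u, hu, fun i _ => hw i⟩

/-- The limit time of a descending chain is random, so the path estimate is applied to countably
many short intervals covering the line, one of which contains the limit. -/
lemma ae_wellFounded_influences [IsProbabilityMeasure P] (hG : IsGraphical P q T S)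
    (hU : U.IsOriented) : ∀ᵐ w ∂P, WellFounded (U.Influences (T w)) := by
  have hball : ∀ a : ℝ, ∃ δ > 0,
      U.displacements.card * waitingLaw (ringsIn (Metric.ball a δ)) < 1 := by
    intro a
    obtain ⟨δ, hδ, h⟩ := exists_ball_ringsIn_lt a
      -- Adding one keeps the factor nonzero even if there are no displacements, so that the strict
      -- inequality survives multiplication.
      (ε := ((U.displacements.card : ℝ≥0∞) + 1)⁻¹) (by simp)
    refine ⟨δ, hδ, ?_⟩
    calc _ ≤ ((U.displacements.card : ℝ≥0∞) + 1) * waitingLaw (ringsIn (Metric.ball a δ)) := by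
          gcongr; exact le_self_add
      _ < ((U.displacements.card : ℝ≥0∞) + 1) * ((U.displacements.card : ℝ≥0∞) + 1)⁻¹ :=
          ENNReal.mul_lt_mul_right (by simp) (by simp) h
      _ = 1 := ENNReal.mul_inv_cancel (by simp) (by simp)
  choose δ hδ hlt using hball
  obtain ⟨C, hC, hcover⟩ := TopologicalSpace.countable_cover_nhds
    (f := fun a => Metric.ball a (δ a)) fun a => Metric.ball_mem_nhds a (hδ a)
  have hpath : ∀ᵐ w ∂P, ∀ a ∈ C, ∀ x, ¬ ∃ u : ℕ → Site d, (∀ i, u i ∈ U.displacements) ∧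
      ∀ i, w ∈ rings T (Metric.ball a (δ a)) (pathSite x u i) :=
    (ae_ball_iff hC).2 fun a _ => hG.ae_no_infinite_path hU Metric.isOpen_ball.measurableSet (hlt a)
  filter_upwards [hpath] with w hw
  rw [wellFounded_iff_isEmpty_descending_chain]
  refine ⟨fun ⟨f, hf⟩ => ?_⟩
  choose u hu hsite htime using hf
  let τ : ℕ → ℝ≥0 := fun n => T w (f n).1 (f n).2
  have hlim : Tendsto (fun n => (τ n : ℝ)) atTop (𝓝 ((⨅ n, τ n : ℝ≥0) : ℝ)) :=
    NNReal.tendsto_coe.2 (tendsto_atTop_ciInf (strictAnti_nat_of_succ_lt htime).antitone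
      (OrderBot.bddBelow _))
  obtain ⟨a, ha, hmem⟩ : ∃ a ∈ C, ((⨅ n, τ n : ℝ≥0) : ℝ) ∈ Metric.ball a (δ a) := by
    have := mem_univ ((⨅ n, τ n : ℝ≥0) : ℝ)
    rw [← hcover] at this
    simpa only [mem_iUnion, exists_prop] using this
  obtain ⟨N, hN⟩ := eventually_atTop.1 (hlim.eventually (Metric.isOpen_ball.mem_nhds hmem))
  -- From index `N` on, all times of the chain lie in the ball, so its tail is a forbidden path.
  refine hw a ha (f N).1 ⟨fun i => u (N + i), fun i => hu _, fun i => ?_⟩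
  have hsites : ∀ i, pathSite (f N).1 (fun i => u (N + i)) i = (f (N + i)).1 := by
    intro i
    induction i with
    | zero => simp [pathSite]
    | succ i ih => rw [pathSite_succ, ih, ← add_assoc, hsite]
  rw [hsites]
  exact ⟨(f (N + i)).2, hN (N + i) (Nat.le_add_right N i)⟩

end IsGraphical

end GraphicalConstruction

/-! ### Restriction to a set of sites and extension by a constant -/

section Extension

variable {ι α : Type*}

open Classical in
/-- Extension of a function on `A` by a constant. -/
noncomputable def extendConst (A : Set ι) (a : α) (f : A → α) : ι → α :=
  fun i => if h : i ∈ A then f ⟨i, h⟩ else a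

lemma extendConst_domRestrict {A : Set ι} {a : α} (f : ι → α) {i : ι} (h : i ∈ A) :
    extendConst A a (A.domRestrict f) i = f i := dif_pos h

lemma measurable_extendConst [MeasurableSpace α] (A : Set ι) (a : α) :
    Measurable (extendConst A a) := by
  refine measurable_pi_iff.2 fun i => ?_
  by_cases h : i ∈ A
  · simpa only [extendConst, dif_pos h] using measurable_pi_apply (⟨i, h⟩ : A)
  · simpa only [extendConst, dif_neg h] using measurable_const

lemma measurable_domRestrict [MeasurableSpace α] (A : Set ι) :
    Measurable (A.domRestrict : (ι → α) → A → α) :=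
  measurable_pi_iff.2 fun i => measurable_pi_apply i.1

end Extension

/-! ### Oriented dependence and exact equilibrium -/

section MainResults

open Filter Topology Set

variable {d : ℕ}

namespace IsGraphical

variable {Ω : Type*} [MeasurableSpace Ω] {P : Measure Ω} {q : ℝ}
  {T : Ω → Clocks d} {S : Ω → Coins d} {U : UpdateFamily d}

lemma indepFun_clocks [IsProbabilityMeasure P] (hG : IsGraphical P q T S) {A B : Set (Site d)} (hAB : Disjoint A B) :
    IndepFun (fun w => A.domRestrict (T w)) (fun w => B.domRestrict (T w)) P := by
  have h := indepFun_of_disjoint hG.measurable_waitingTimes hG.iIndepFun_waitingTimes hAB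
  -- Independence is given for waiting times; the ring times are recovered as their partial sums.
  have hφ : ∀ C : Set (Site d), Measurable fun (s : C → ℕ → ℝ) (y : C) (k : ℕ) =>
      (ringTime (s y) k).toNNReal := fun C =>
    measurable_pi_iff.2 fun y => measurable_pi_iff.2 fun k =>
      ((measurable_ringTime k).comp (measurable_pi_apply y)).real_toNNReal
  convert! h.comp (hφ A) (hφ B) using 1 <;>
  · funext w y k
    simp [ringTime_waitingTime]

lemma indepFun_coins [IsProbabilityMeasure P] (hG : IsGraphical P q T S) {A B : Set (Site d)} (hAB : Disjoint A B) :
    IndepFun (fun w => A.domRestrict (S w)) (fun w => B.domRestrict (S w)) P := by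
  have hm : ∀ x k, Measurable fun w => S w x k := fun x k =>
    (measurable_pi_apply k).comp ((measurable_pi_apply x).comp hG.measurable_coins)
  exact indepFun_of_disjoint (f := fun x w => S w x) (fun x => measurable_pi_iff.2 (hm x))
    (iIndepFun_rows (X := fun x k w => S w x k) hm hG.indep_coins) hAB

lemma indepFun_clocks_coins_restrict [IsProbabilityMeasure P] (hG : IsGraphical P q T S) {A B : Set (Site d)}
    (hAB : Disjoint A B) :
    IndepFun (fun w => (A.domRestrict (T w), A.domRestrict (S w)))
      (fun w => (B.domRestrict (T w), B.domRestrict (S w))) P :=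
  indepFun_prodMk_prodMk ((measurable_domRestrict A).comp hG.measurable_clocks)
    ((measurable_domRestrict B).comp hG.measurable_clocks)
    ((measurable_domRestrict A).comp hG.measurable_coins)
    ((measurable_domRestrict B).comp hG.measurable_coins)
    (hG.indepFun_clocks hAB) (hG.indepFun_coins hAB)
    (hG.indep_clocks_coins.comp ((measurable_domRestrict A).prodMk (measurable_domRestrict B))
      ((measurable_domRestrict A).prodMk (measurable_domRestrict B)))

lemma indepFun_clocks_coins_coin [IsProbabilityMeasure P] (hG : IsGraphical P q T S) {A : Set (Site d)} {x : Site d}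
    (hx : x ∉ A) (k : ℕ) :
    IndepFun (fun w => (T w, A.domRestrict (S w))) (fun w => S w x k) P := by
  have hx' : Disjoint A {x} := disjoint_singleton_right.2 hx
  have mA := (measurable_domRestrict A).comp hG.measurable_coins
  have mB := (measurable_domRestrict {x}).comp hG.measurable_coins
  -- The trivial second variable leaves all clocks, including the one at `x`, on the side of the
  -- coins in `A`.
  have h := indepFun_prodMk_prodMk (X₂ := fun _ => ()) hG.measurable_clocks measurable_const mA mB
    (indepFun_const_right _ _) (hG.indepFun_coins hx')
    (hG.indep_clocks_coins.comp (measurable_id.prodMk measurable_const)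
      ((measurable_domRestrict A).prodMk (measurable_domRestrict {x})))
  exact h.comp measurable_id (((measurable_pi_apply k).comp
    (measurable_pi_apply (⟨x, rfl⟩ : ({x} : Set (Site d))))).comp measurable_snd)

lemma ae_wellPosed [IsProbabilityMeasure P] (hG : IsGraphical P q T S) (hU : U.IsOriented) :
    ∀ᵐ w ∂P, UpdateFamily.RegularClocks (T w) ∧ WellFounded (U.Influences (T w)) :=
  hG.ae_regularClocks.and (hG.ae_wellFounded_influences hU)

end IsGraphical

namespace UpdateFamily

/-- The flow on `A` driven by the data on `A`. -/
noncomputable def restrictedFlow (U : UpdateFamily d) (A : Set (Site d))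
    (p : (A → Fin 2) × (A → ℕ → ℝ≥0) × (A → ℕ → Fin 2)) (t : ℝ≥0) : A → Fin 2 :=
  A.domRestrict (U.flow (extendConst A 0 p.1) (extendConst A 0 p.2.1) (extendConst A 0 p.2.2) t)

lemma measurable_restrictedFlow (U : UpdateFamily d) (A : Set (Site d)) :
    Measurable (U.restrictedFlow A) := by
  refine measurable_pi_iff.2 fun t => measurable_pi_iff.2 fun y => ?_
  exact (U.measurable_flow t y.1).comp
    (((measurable_extendConst A 0).comp measurable_fst).prodMk
      (((measurable_extendConst A 0).comp measurable_snd.fst).prodMk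
        ((measurable_extendConst A 0).comp measurable_snd.snd)))

/-- Locality makes the extension by `0` harmless. The extended clocks ring only at time `0` outside
`A` and so are not regular there, which is why the everywhere-defined `flow` is used in place of
`kcm`. -/
lemma domRestrict_flow (U : UpdateFamily d) {A : Set (Site d)}
    (hA : ∀ y ∈ A, ∀ u ∈ U.displacements, y + u ∈ A) (ω : Config d) (τ : Clocks d) (σ : Coins d)
    (t : ℝ≥0) : A.domRestrict (U.flow ω τ σ t) =
      U.restrictedFlow A (A.domRestrict ω, A.domRestrict τ, A.domRestrict σ) t := by
  funext y
  exact flow_congr hA (fun z hz => (extendConst_domRestrict _ hz).symm)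
    (fun z hz => (extendConst_domRestrict _ hz).symm) (fun z hz => (extendConst_domRestrict _ hz).symm) y.2 t

end UpdateFamily

namespace IsGraphical

variable {Ω : Type*} [MeasurableSpace Ω] {P : Measure Ω} {q : ℝ}
  {T : Ω → Clocks d} {S : Ω → Coins d} {U : UpdateFamily d}

lemma ae_domRestrict_kcm [IsProbabilityMeasure P] (hG : IsGraphical P q T S) (hU : U.IsOriented) {A : Set (Site d)}
    (hA : ∀ y ∈ A, ∀ u ∈ U.displacements, y + u ∈ A) :
    ∀ᵐ w ∂P, ∀ (ω : Config d) (t : ℝ≥0), A.domRestrict (U.kcm ω (T w) (S w) t) =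
      U.restrictedFlow A (A.domRestrict ω, A.domRestrict (T w), A.domRestrict (S w)) t := by
  filter_upwards [hG.ae_wellPosed hU] with w hw ω t
  rw [hw.1.kcm_eq_flow hw.2, U.domRestrict_flow hA]

lemma indepFun_domRestrict_kcm [IsProbabilityMeasure P] (hG : IsGraphical P q T S) (hU : U.IsOriented) {A : Set (Site d)}
    (hA : ∀ y ∈ A, ∀ u ∈ U.displacements, y + u ∈ A) {ξ : Ω → Config d} (mξ : Measurable ξ)
    (hξ : IndepFun ξ (fun w => (T w, S w)) P)
    (hξA : IndepFun (fun w => A.domRestrict (ξ w)) (fun w => Aᶜ.domRestrict (ξ w)) P) :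
    IndepFun (fun w (t : ℝ≥0) => A.domRestrict (U.kcm (ξ w) (T w) (S w) t))
      (fun w => (Aᶜ.domRestrict (ξ w), Aᶜ.domRestrict (T w), Aᶜ.domRestrict (S w))) P := by
  have m : ∀ C : Set (Site d), Measurable fun w => (C.domRestrict (T w), C.domRestrict (S w)) :=
    fun C => ((measurable_domRestrict C).comp hG.measurable_clocks).prodMk
      ((measurable_domRestrict C).comp hG.measurable_coins)
  have mC : ∀ C : Set (Site d), Measurable fun p : Clocks d × Coins d =>
      (C.domRestrict p.1, C.domRestrict p.2) :=
    fun C => ((measurable_domRestrict C).comp measurable_fst).prodMk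
      ((measurable_domRestrict C).comp measurable_snd)
  have h := indepFun_prodMk_prodMk ((measurable_domRestrict A).comp mξ)
    ((measurable_domRestrict Aᶜ).comp mξ) (m A) (m Aᶜ) hξA
    (hG.indepFun_clocks_coins_restrict disjoint_compl_right)
    (hξ.comp ((measurable_domRestrict A).prodMk (measurable_domRestrict Aᶜ))
      ((mC A).prodMk (mC Aᶜ)))
  refine (h.comp (U.measurable_restrictedFlow A) measurable_id).congr ?_ ae_eq_rfl
  filter_upwards [hG.ae_domRestrict_kcm hU hA] with w hw
  exact funext fun t => (hw (ξ w) t).symm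

/-- Ring `k` carries the last legal update at `x` by time `t`. -/
def lastLegal (U : UpdateFamily d) (ω : Config d) (T : Ω → Clocks d) (S : Ω → Coins d)
    (x : Site d) (t : ℝ≥0) (k : ℕ) : Set Ω :=
  {w | UpdateFamily.LastMarked (T w) (U.limitLegal ω (T w) (S w)) (Iic t) x k}

lemma disjoint_lastLegal {Ω : Type*} {T : Ω → Clocks d} {S : Ω → Coins d} (ω : Config d) (x : Site d) (t : ℝ≥0) :
    Pairwise (Function.onFun Disjoint (lastLegal U ω T S x t)) :=
  fun _ _ hjk => disjoint_left.2 fun _ hj hk => hjk (hj.unique hk)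

lemma measurableSet_lastLegal (hG : IsGraphical P q T S) (ω : Config d) (x : Site d) (t : ℝ≥0)
    (k : ℕ) : MeasurableSet (lastLegal U ω T S x t k) :=
  measurableSet_setOfPred.2 ((UpdateFamily.measurable_lastMarked
    (L := fun z => U.limitLegal z.1 z.2.1 z.2.2)
    (U.measurable_limitLegal x) (UpdateFamily.measurable_ring_le x t) k).comp
    (measurable_const.prodMk (hG.measurable_clocks.prodMk hG.measurable_coins)))

lemma measurableSet_coin (hG : IsGraphical P q T S) (x : Site d) (k : ℕ) :
    MeasurableSet {w | S w x k = 1} :=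
  ((measurable_pi_apply k).comp ((measurable_pi_apply x).comp hG.measurable_coins))
    (measurableSet_singleton 1)

/-- Whether ring `k` is the last legal one by time `t` is decided by the clocks and the coins in the
open half-space below `x`. The coin of that ring is independent of these. -/
lemma measure_lastLegal_inter [IsProbabilityMeasure P] (hG : IsGraphical P q T S) (hU : U.IsOriented) (ω : Config d)
    (x : Site d) (t : ℝ≥0) (k : ℕ) : P (lastLegal U ω T S x t k ∩ {w | S w x k = 1}) =
      P (lastLegal U ω T S x t k) * ENNReal.ofReal (1 - q) := by
  obtain ⟨v, -, hv⟩ := hU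
  set A := siteHalfSpace v x with hA
  have hxA : x ∉ A := fun h => lt_irrefl _ (mem_siteHalfSpace.1 h)
  let B : Set (Clocks d × (A → ℕ → Fin 2)) := {p | UpdateFamily.LastMarked p.1
    (U.limitLegal ω p.1 (extendConst A 0 p.2)) (Iic t) x k}
  have mB : MeasurableSet B := measurableSet_setOfPred.2 ((UpdateFamily.measurable_lastMarked
    (L := fun z => U.limitLegal z.1 z.2.1 z.2.2)
    (U.measurable_limitLegal x) (UpdateFamily.measurable_ring_le x t) k).comp
    (measurable_const.prodMk (measurable_fst.prodMk
      ((measurable_extendConst A 0).comp measurable_snd))))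
  have hB : lastLegal U ω T S x t k = (fun w => (T w, A.domRestrict (S w))) ⁻¹' B := by
    ext w
    have h : ∀ j, U.limitLegal ω (T w) (S w) x j ↔
        U.limitLegal ω (T w) (extendConst A 0 (A.domRestrict (S w))) x j :=
      UpdateFamily.limitLegal_congr (hv.add_mem_siteHalfSpace x) (fun _ _ => rfl)
        (fun _ _ => rfl) (fun y hy => (extendConst_domRestrict _ hy).symm) rfl
        fun u hu => mem_siteHalfSpace.2 (hv.height_add_lt x hu)
    simp only [lastLegal, UpdateFamily.LastMarked, B, mem_preimage, mem_ofPred_eq, h]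
  rw [hB, ← hG.coin_law x k]
  exact (hG.indepFun_clocks_coins_coin hxA k).measure_inter_preimage_eq_mul B {1} mB
    (measurableSet_singleton 1)

lemma ae_eq_legalUpdateBy [IsProbabilityMeasure P] (hG : IsGraphical P q T S) (hU : U.IsOriented) (ω : Config d)
    (x : Site d) (t : ℝ≥0) : {w | U.LegalUpdateBy ω (T w) (S w) x t} =ᵐ[P]
      ⋃ k, lastLegal U ω T S x t k := by
  filter_upwards [hG.ae_wellPosed hU] with w hw
  refine propext ((hw.1.legalUpdateBy_iff hw.2 ω (S w) x t).trans ⟨fun h => ?_, fun h => ?_⟩)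
  · exact mem_iUnion.2 (hw.1.exists_lastMarked h)
  · obtain ⟨k, hk⟩ := mem_iUnion.1 h
    exact ⟨k, hk.1⟩

lemma ae_eq_occupied [IsProbabilityMeasure P] (hG : IsGraphical P q T S) (hU : U.IsOriented) (ω : Config d)
    (x : Site d) (t : ℝ≥0) : {w | U.kcm ω (T w) (S w) t x = 1} =ᵐ[P]
      {w | U.flow ω (T w) (S w) t x = 1} := by
  filter_upwards [hG.ae_wellPosed hU] with w hw
  have := hw.1.kcm_eq_flow hw.2 ω (S w)
  exact congrArg (fun η : ℝ≥0 → Config d => η t x = 1) this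

lemma measurableSet_flow (hG : IsGraphical P q T S) (ω : Config d) (x : Site d) (t : ℝ≥0) :
    MeasurableSet {w | U.flow ω (T w) (S w) t x = 1} :=
  ((U.measurable_flow t x).comp
    (measurable_const.prodMk (hG.measurable_clocks.prodMk hG.measurable_coins)))
    (measurableSet_singleton 1)

lemma nullMeasurableSet_legalUpdateBy [IsProbabilityMeasure P] (hG : IsGraphical P q T S) (hU : U.IsOriented)
    (ω : Config d) (x : Site d) (t : ℝ≥0) :
    NullMeasurableSet {w | U.LegalUpdateBy ω (T w) (S w) x t} P :=
  (MeasurableSet.iUnion (hG.measurableSet_lastLegal ω x t)).nullMeasurableSet.congr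
    (hG.ae_eq_legalUpdateBy hU ω x t).symm

lemma cond_legalUpdateBy [IsProbabilityMeasure P] (hG : IsGraphical P q T S) (hU : U.IsOriented) (ω : Config d)
    (x : Site d) (t : ℝ≥0) (h0 : P {w | U.LegalUpdateBy ω (T w) (S w) x t} ≠ 0) :
    ProbabilityTheory.cond P {w | U.LegalUpdateBy ω (T w) (S w) x t}
      {w | U.kcm ω (T w) (S w) t x = 1} = ENNReal.ofReal (1 - q) := by
  have hE := hG.ae_eq_legalUpdateBy hU ω x t
  have hinter : ({w | U.kcm ω (T w) (S w) t x = 1} ∩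
      {w | U.LegalUpdateBy ω (T w) (S w) x t} : Set Ω) =ᵐ[P]
      ⋃ k, lastLegal U ω T S x t k ∩ {w | S w x k = 1} := by
    -- Split according to the last legal ring: if it is the `k`-th, the state of `x` is the `k`-th
    -- coin.
    refine ((hG.ae_eq_occupied hU ω x t).inter hE).trans (Eq.eventuallyEq ?_)
    rw [inter_iUnion]
    refine iUnion_congr fun k => ?_
    rw [inter_comm]
    ext w
    refine and_congr_right fun hk => ?_
    rw [mem_ofPred_eq, UpdateFamily.flow, hk.stateOf_eq]
    rfl
  have hsum : P ({w | U.kcm ω (T w) (S w) t x = 1} ∩ {w | U.LegalUpdateBy ω (T w) (S w) x t}) =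
      P {w | U.LegalUpdateBy ω (T w) (S w) x t} * ENNReal.ofReal (1 - q) := by
    rw [measure_congr hinter, measure_congr hE, measure_iUnion (disjoint_lastLegal ω x t)
      (hG.measurableSet_lastLegal ω x t), measure_iUnion
      (fun _ _ h => (disjoint_lastLegal ω x t h).mono inter_subset_left inter_subset_left)
      (fun k => (hG.measurableSet_lastLegal ω x t k).inter (hG.measurableSet_coin x k)),
      ← ENNReal.tsum_mul_right]
    exact tsum_congr (hG.measure_lastLegal_inter hU ω x t)
  -- The conditioning event is only known to be null measurable, hence the null-measurable version
  -- of the restriction formula.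
  rw [ProbabilityTheory.cond, Measure.smul_apply, smul_eq_mul,
    Measure.restrict_apply₀' (hG.nullMeasurableSet_legalUpdateBy hU ω x t), hsum, ← mul_assoc,
    ENNReal.inv_mul_cancel h0 (measure_ne_top _ _), one_mul]

end IsGraphical

end MainResults

theorem mainTheorem11 {d : ℕ} (U : UpdateFamily d) (hU : U.IsOriented) :
    -- oriented dependence
    (∀ v : Fin d → ℝ, v ≠ 0 → U.ContainedIn v → ∀ (x : Site d) (A : Set (Site d)),
      A = siteHalfSpace v x →
      ∃ F : (A → Fin 2) × (A → ℕ → ℝ≥0) × (A → ℕ → Fin 2) → ℝ≥0 → A → Fin 2,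
        Measurable F ∧
        ∀ (q : ℝ), q ∈ Set.Icc (0 : ℝ) 1 →
        ∀ (Ω : Type*) [MeasurableSpace Ω] (P : Measure Ω) [IsProbabilityMeasure P]
          (T : Ω → Clocks d) (S : Ω → Coins d), IsGraphical P q T S →
          (∀ᵐ w ∂P, ∀ (ω : Config d) (t : ℝ≥0),
            A.domRestrict (U.kcm ω (T w) (S w) t)
              = F (A.domRestrict ω, A.domRestrict (T w), A.domRestrict (S w)) t) ∧
          (∀ ξ : Ω → Config d, Measurable ξ →
            IndepFun ξ (fun w => (T w, S w)) P →
            IndepFun (fun w => A.domRestrict (ξ w)) (fun w => Aᶜ.domRestrict (ξ w)) P →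
            IndepFun
              (fun w (t : ℝ≥0) => A.domRestrict (U.kcm (ξ w) (T w) (S w) t))
              (fun w => (Aᶜ.domRestrict (ξ w), Aᶜ.domRestrict (T w), Aᶜ.domRestrict (S w))) P)) ∧
    -- the graphical construction is well posed, and exact equilibrium holds
    (∀ (q : ℝ), q ∈ Set.Icc (0 : ℝ) 1 →
      ∀ (Ω : Type*) [MeasurableSpace Ω] (P : Measure Ω) [IsProbabilityMeasure P]
        (T : Ω → Clocks d) (S : Ω → Coins d), IsGraphical P q T S →
        (∀ᵐ w ∂P, ∀ ω : Config d, ∃! η, U.IsTrajectory ω (T w) (S w) η) ∧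
        ∀ (ω : Config d) (x : Site d) (t : ℝ≥0),
          NullMeasurableSet {w | U.LegalUpdateBy ω (T w) (S w) x t} P ∧
          NullMeasurableSet {w | U.kcm ω (T w) (S w) t x = 1} P ∧
          (P {w | U.LegalUpdateBy ω (T w) (S w) x t} ≠ 0 →
            ProbabilityTheory.cond P {w | U.LegalUpdateBy ω (T w) (S w) x t}
              {w | U.kcm ω (T w) (S w) t x = 1} = ENNReal.ofReal (1 - q))) := by
  refine ⟨fun v _ hv x A hA => ⟨U.restrictedFlow A, U.measurable_restrictedFlow A,
    fun q _ Ω _ P _ T S hG => ?_⟩, fun q _ Ω _ P _ T S hG => ⟨?_, fun ω x t => ?_⟩⟩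
  · subst hA
    exact ⟨hG.ae_domRestrict_kcm hU (hv.add_mem_siteHalfSpace x), fun ξ mξ hξ hξA =>
      hG.indepFun_domRestrict_kcm hU (hv.add_mem_siteHalfSpace x) mξ hξ hξA⟩
  · filter_upwards [hG.ae_wellPosed hU] with w hw ω
    exact (hw.1.existsUnique_isTrajectory hw.2 ω (S w)).2
  · exact ⟨hG.nullMeasurableSet_legalUpdateBy hU ω x t,
      (hG.measurableSet_flow ω x t).nullMeasurableSet.congr (hG.ae_eq_occupied hU ω x t).symm,
      hG.cond_legalUpdateBy hU ω x t⟩
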